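/- **Setting.** Let $(\mathbf M,\rho)$ be a nonempty compact metric space on which a group $G$ acts by isometries, 2-point-homogeneously: if $\rho(x,y)=\rho(x',y')$, then some $g\in G$ has $g(x)=x'$, $g(y)=y'$. Let $\mu$ be the $G$-invariant Borel probability measure on $\mathbf M$. Let $\tau(x,y)=F(\rho(x,y))$ for a function $F:\mathbb R\to\mathbb R$. Let $L^2(\mathbf M,\mu)$ be the closure of the sum of mutually orthogonal, finite-dimensional, $G$-irreducible spaces $V_k$ of continuous complex functions, indexed by the integers $0\le k\le N$ with $N\in\{0,1,2,\dots\}\cup\{\infty\}$ ($N$ is finite exactly when $\mathbf M$ is finite). Let $\Phi_k$ be the zonal spherical function of $V_k$: for every $x\in\mathbf M$ the function $y\mapsto\Phi_k(\tau(x,y))$ belongs to $V_k$, and $\Phi_k(\tau(x,x))=1$. Assume that, for every $k\le N$, $\Phi_k(t)=\sum_{d=0}^k p_{kd}t^d$ is a real polynomial of degree $k$. Let $T=\{\tau(x,y):x,y\in\mathbf M\}$ and $S=T\cap[a,b]$. A finite set $C\subset\mathbf M$ is an $S$-code if $\tau(x,y)\in S$ for all distinct $x,y\in C$; $A(\mathbf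 M,S)\in\{0,1,2,\dots\}\cup\{\infty\}$ is the supremum of $|C|$ over all $S$-codes $C$. **The SDPA problem.** Let $\ell\ge1$, $a=u_1<u_2<\dots<u_{\ell+1}=b$ and $m\ge1$. For an $S$-code $C$ let $x_i^{(k)}(C)=\sum\tau(x,y)^k$, the sum over the ordered pairs of distinct $x,y\in C$ with $\tau(x,y)\in[u_i,u_{i+1})$ if $i<\ell$, and with $\tau(x,y)\in[u_\ell,b]$ if $i=\ell$. Let $Ad$ be a set (possibly empty) of positive semidefinite constraints $$A_0+cA_1+\sum_{i=1}^{\ell}\sum_{k=0}^{2m-1}x_i^{(k)}B_{i,k}\succeq0$$ with real symmetric matrices (of any size, depending on the constraint), each of which is satisfied by $c=|C|$, $x_i^{(k)}=x_i^{(k)}(C)$ for every nonempty $S$-code $C$. The SDPA problem is to maximize $c$ over real numbers $c$ and $x_i^{(k)}$ ($1\le i\le\ell$, $0\le k\le 2m-1$) subject to - (5) $\begin{pmatrix}1&c\\c&z\end{pmatrix}\succeq0$, where $z=c+x_1^{(0)}+\dots+x_\ell^{(0)}$; - (6) $c+\sum_{d=0}^kp_{kd}\sum_{i=1}^\ell x_i^{(d)}\ge0$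 for all $1\le k\le 2m-1$ with $k\le N$; - (7) $H_m(x_i^{(0)},\dots,x_i^{(2m-1)},[u_i,u_{i+1}])\succeq0$ for $i=1,\dots,\ell$, where $H_m(s_0,\dots,s_{2m-1},[\alpha,\beta])$ is the block-diagonal matrix with the $m\times m$ blocks $(s_{i+j})$, $(s_{i+j+1}-\alpha s_{i+j})$ and $(\beta s_{i+j}-s_{i+j+1})$, $0\le i,j\le m-1$; - (8) all constraints in $Ad$. Let $c^*(m)\in[-\infty,\infty]$ be the optimal value of this problem, i.e. the supremum of $c$ over all feasible points. **Theorem 6.1.** For every natural number $m\ge1$ and all data as above, $A(\mathbf M,S)\le c^*(m)$. -/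

import Mathlib

open MeasureTheory Polynomial
open scoped Matrix ENNReal

namespace CodeBound

/-! ## Two-point-homogeneous spaces and zonal spherical functions -/

/-- The group `G` acts on the metric space `M` by isometries, and any two pairs of points at equal
distance are related by an element of `G`. -/
structure IsTwoPointHomogeneous (G M : Type*) [MetricSpace M] [Group G] [MulAction G M] : Prop where
  dist_smul : ∀ (g : G) (x y : M), dist (g • x) (g • y) = dist x y
  exists_smul : ∀ x y x' y' : M, dist x y = dist x' y' → ∃ g : G, g • x = x' ∧ g • y = y'

/-- The space `W` of continuous functions is stable under all translations `f ↦ f (g • ·)`. -/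
def IsInvariant (G : Type*) {M : Type*} [MetricSpace M] [Group G] [MulAction G M]
    (W : Submodule ℂ C(M, ℂ)) : Prop :=
  ∀ g : G, ∀ f ∈ W, ∃ f' ∈ W, ∀ x : M, f' x = f (g • x)

/-- `W` is an irreducible representation of `G` (by translation of functions). -/
def IsIrreducible (G : Type*) {M : Type*} [MetricSpace M] [Group G] [MulAction G M]
    (W : Submodule ℂ C(M, ℂ)) : Prop :=
  IsInvariant G W ∧ W ≠ ⊥ ∧ ∀ U : Submodule ℂ C(M, ℂ), U ≤ W → IsInvariant G U → U = ⊥ ∨ U = W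

/-- `V 0, V 1, …` (all `V k` with `k ≤ N`, where `N` may be infinite) is a decomposition of
`L²(M, μ)` into mutually orthogonal finite-dimensional irreducible representations of `G`,
consisting of continuous functions. The `V k` with `k > N` play no role. -/
structure IsHarmonicDecomposition (G : Type*) {M : Type*} [MetricSpace M] [CompactSpace M]
    [MeasurableSpace M] [BorelSpace M] [Group G] [MulAction G M]
    (μ : Measure M) [IsFiniteMeasure μ] (N : ℕ∞) (V : ℕ → Submodule ℂ C(M, ℂ)) : Prop where
  finiteDimensional : ∀ k : ℕ, (k : ℕ∞) ≤ N → FiniteDimensional ℂ (V k)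
  irreducible : ∀ k : ℕ, (k : ℕ∞) ≤ N → IsIrreducible G (V k)
  orthogonal : ∀ j k : ℕ, (j : ℕ∞) ≤ N → (k : ℕ∞) ≤ N → j ≠ k →
    ∀ f ∈ V j, ∀ h ∈ V k, ∫ x, (starRingEnd ℂ) (f x) * h x ∂μ = 0
  dense : ((⨆ (k : ℕ) (_ : (k : ℕ∞) ≤ N), V k).map
    (ContinuousMap.toLp (E := ℂ) 2 μ ℂ).toLinearMap).topologicalClosure = ⊤

/-- The parameter `τ(x, y) = F(ρ(x, y))`, a function of the distance. -/
def tau {M : Type*} [MetricSpace M] (F : ℝ → ℝ) (x y : M) : ℝ := F (dist x y)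

/-- The polynomial `φ`, as a function of `τ`, is the zonal spherical function of the
representation `W`: for every base point `x`, the function `y ↦ φ(τ(x, y))` (which is invariant
under the stabilizer of `x`) belongs to `W`, and it takes the value `1` at the base point. -/
structure IsZonalSpherical {M : Type*} [MetricSpace M] (F : ℝ → ℝ)
    (W : Submodule ℂ C(M, ℂ)) (φ : ℝ[X]) : Prop where
  mem : ∀ x : M, ∃ f ∈ W, ∀ y : M, f y = ((φ.eval (tau F x y) : ℝ) : ℂ)
  normalized : ∀ x : M, φ.eval (tau F x x) = 1

/-! ## Codes -/

/-- The set `T` of all values of `τ`. -/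
def tauRange (M : Type*) [MetricSpace M] (F : ℝ → ℝ) : Set ℝ :=
  {t | ∃ x y : M, tau F x y = t}

/-- A finite set `C` is an `S`-code if `τ(x, y) ∈ S` for all distinct `x, y ∈ C`. -/
def IsCode {M : Type*} [MetricSpace M] (F : ℝ → ℝ) (S : Set ℝ) (C : Finset M) : Prop :=
  ∀ x ∈ C, ∀ y ∈ C, x ≠ y → tau F x y ∈ S

/-- `A(M, S)`, the supremum (possibly infinite) of the cardinalities of `S`-codes. -/
noncomputable def maxCodeSize (M : Type*) [MetricSpace M] (F : ℝ → ℝ) (S : Set ℝ) : ℕ∞ :=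
  ⨆ (C : Finset M) (_ : IsCode F S C), (C.card : ℕ∞)

/-- The `i`-th part of the partition of `[u 0, u ℓ]` by the points `u 0 < ⋯ < u ℓ`:
half-open intervals, except the last one, which is closed. -/
def piece {ℓ : ℕ} (u : Fin (ℓ + 1) → ℝ) (i : Fin ℓ) : Set ℝ :=
  if (i : ℕ) + 1 = ℓ then Set.Icc (u i.castSucc) (u i.succ)
  else Set.Ico (u i.castSucc) (u i.succ)

open Classical in
/-- The sum of `τ(x, y) ^ d` over the ordered pairs of distinct points of `C` whose `τ` lies in
the `i`-th part of the partition `u`. -/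
noncomputable def powerSum {M : Type*} [MetricSpace M] (F : ℝ → ℝ) {ℓ : ℕ} (u : Fin (ℓ + 1) → ℝ)
    (C : Finset M) (i : Fin ℓ) (d : ℕ) : ℝ :=
  ∑ p ∈ C.offDiag with tau F p.1 p.2 ∈ piece u i, tau F p.1 p.2 ^ d

/-! ## The semidefinite program -/

/-- The Hankel matrix `R_m = (s_{i+j})`. -/
def hankelR {m : ℕ} (s : Fin (2 * m) → ℝ) : Matrix (Fin m) (Fin m) ℝ :=
  Matrix.of fun i j => s ⟨i + j, by omega⟩

/-- The matrix `F_m^+(a) = (s_{i+j+1} - a s_{i+j})`. -/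
def hankelPlus {m : ℕ} (s : Fin (2 * m) → ℝ) (a : ℝ) : Matrix (Fin m) (Fin m) ℝ :=
  Matrix.of fun i j => s ⟨i + j + 1, by omega⟩ - a * s ⟨i + j, by omega⟩

/-- The matrix `F_m^-(b) = (b s_{i+j} - s_{i+j+1})`. -/
def hankelMinus {m : ℕ} (s : Fin (2 * m) → ℝ) (b : ℝ) : Matrix (Fin m) (Fin m) ℝ :=
  Matrix.of fun i j => b * s ⟨i + j, by omega⟩ - s ⟨i + j + 1, by omega⟩

/-- The block-diagonal matrix `H_m(s_0, …, s_{2m-1}, [a, b])`. -/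
def hankelH {m : ℕ} (s : Fin (2 * m) → ℝ) (a b : ℝ) :
    Matrix (Fin m ⊕ (Fin m ⊕ Fin m)) (Fin m ⊕ (Fin m ⊕ Fin m)) ℝ :=
  Matrix.fromBlocks (hankelR s) 0 0 (Matrix.fromBlocks (hankelPlus s a) 0 0 (hankelMinus s b))

/-- A positive semidefinite constraint (linear matrix inequality) in the variables `c` and
`x i d`, `i < ℓ`, `d < 2m`: symmetric real matrices `A₀`, `A₁`, `B i d` of some size. -/
structure PsdConstraint (ℓ m : ℕ) where
  size : ℕ
  A₀ : Matrix (Fin size) (Fin size) ℝ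
  A₁ : Matrix (Fin size) (Fin size) ℝ
  B : Fin ℓ → Fin (2 * m) → Matrix (Fin size) (Fin size) ℝ
  A₀_symm : A₀.IsSymm
  A₁_symm : A₁.IsSymm
  B_symm : ∀ i d, (B i d).IsSymm

/-- The constraint `A₀ + c A₁ + ∑ x i d • B i d ⪰ 0` holds at `(c, x)`. -/
def PsdConstraint.Holds {ℓ m : ℕ} (L : PsdConstraint ℓ m) (c : ℝ)
    (x : Fin ℓ → Fin (2 * m) → ℝ) : Prop :=
  (L.A₀ + c • L.A₁ + ∑ i, ∑ d, x i d • L.B i d).PosSemidef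

/-- `(c, x)` is feasible for the program with polynomials `Φ k`, `k ≤ N`, partition `u`,
order `m ≥ 1` and additional constraints `Ad`. -/
structure IsFeasible (N : ℕ∞) (Φ : ℕ → ℝ[X]) {ℓ : ℕ} (u : Fin (ℓ + 1) → ℝ) (m : ℕ) (hm : 0 < m)
    (Ad : Set (PsdConstraint ℓ m)) (c : ℝ) (x : Fin ℓ → Fin (2 * m) → ℝ) : Prop where
  /-- `[[1, c], [c, z]] ⪰ 0`, with `z = c + x₁⁽⁰⁾ + ⋯ + x_ℓ⁽⁰⁾`. -/
  gamma : (!![1, c; c, c + ∑ i, x i ⟨0, by omega⟩] : Matrix (Fin 2) (Fin 2) ℝ).PosSemidef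
  /-- The Delsarte constraints, for the existing `k` among `1, …, 2m - 1`. -/
  delsarte : ∀ k : ℕ, 1 ≤ k → ∀ hk : k < 2 * m, (k : ℕ∞) ≤ N →
    0 ≤ c + ∑ d : Fin (k + 1), (Φ k).coeff d * ∑ i, x i ⟨d, by omega⟩
  hankel : ∀ i, (hankelH (x i) (u i.castSucc) (u i.succ)).PosSemidef
  additional : ∀ L ∈ Ad, L.Holds c x

/-- The optimal value `c*(m)`: the supremum, in the extended reals, of all `c` that are attained
at feasible points (`+∞` if the program is unbounded). -/
noncomputable def optimalValue (N : ℕ∞) (Φ : ℕ → ℝ[X]) {ℓ : ℕ} (u : Fin (ℓ + 1) → ℝ)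
    (m : ℕ) (hm : 0 < m) (Ad : Set (PsdConstraint ℓ m)) : EReal :=
  sSup {v : EReal | ∃ (c : ℝ) (x : Fin ℓ → Fin (2 * m) → ℝ),
    IsFeasible N Φ u m hm Ad c x ∧ v = (c : EReal)}

end CodeBound

/-! The kernel `(x, y) ↦ Φ_k(τ(x, y))` is positive semidefinite: being invariant under `G`, it
defines an integral operator on `V_k` that commutes with `G` and hence, by Schur's lemma, is a
scalar. So the kernel reproduces `V_k` up to a factor, which makes it a positive multiple of the
Gram matrix of its own sections in `L²(μ)`. Summed over the pairs of points of a code `C`, this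
gives the Delsarte constraints. The power sums of `C` over a subinterval are the moments of a
discrete measure on that subinterval, whence the Hankel constraints. Thus `|C|` and the power sums
of `C` form a feasible point of the semidefinite program. -/

namespace CodeBound

section PosSemidef

open scoped ComplexOrder in
theorem gram_posSemidef {𝕜 n E : Type*} [RCLike 𝕜] [SeminormedAddCommGroup E]
    [InnerProductSpace 𝕜 E] (v : n → E) : (Matrix.gram 𝕜 v).PosSemidef := by
  refine ⟨Matrix.isHermitian_gram 𝕜 v, fun a => ?_⟩
  have h_inner : (a.sum fun i ai => a.sum fun j aj => star ai * Matrix.gram 𝕜 v i j * aj) =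
      inner 𝕜 (a.sum fun i ai => ai • v i) (a.sum fun j aj => aj • v j) := by
    rw [Finsupp.sum_inner]
    refine Finsupp.sum_congr fun i _ => ?_
    rw [Finsupp.inner_sum]
    refine Finsupp.sum_congr fun j _ => ?_
    rw [inner_smul_left, inner_smul_right, Matrix.gram_apply, starRingEnd_apply]
    ring
  rw [h_inner, inner_self_eq_norm_sq_to_K]
  positivity

open scoped ComplexOrder in
theorem posSemidef_of_map_ofReal {n : Type*} {A : Matrix n n ℝ}
    (hA : (A.map Complex.ofReal).PosSemidef) : A.PosSemidef := by
  refine ⟨?_, fun a => ?_⟩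
  · ext i j
    exact Complex.ofReal_injective (by simpa using hA.1.apply i j)
  · have h := hA.2 (a.mapRange Complex.ofReal Complex.ofReal_zero)
    simp only [Finsupp.sum, Finsupp.support_mapRange_of_injective _ _ Complex.ofReal_injective,
      Finsupp.mapRange_apply, Matrix.map_apply, Complex.star_def, Complex.conj_ofReal] at h
    exact_mod_cast h

theorem sum_sum_nonneg_of_posSemidef {X : Type*} {K : Matrix X X ℝ} (hK : K.PosSemidef)
    (C : Finset X) : 0 ≤ ∑ x ∈ C, ∑ y ∈ C, K x y := by
  have h := (hK.submatrix ((↑) : C → X)).dotProduct_mulVec_nonneg 1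
  simp only [dotProduct, Matrix.mulVec, Matrix.submatrix_apply, Pi.star_apply, Pi.one_apply,
    star_one, one_mul, mul_one, Finset.sum_coe_sort C] at h
  rwa [Finset.sum_coe_sort C fun x => ∑ y ∈ C, K x y] at h

theorem posSemidef_fromBlocks_zero {p q R : Type*} [Finite p] [Finite q] [Ring R] [PartialOrder R]
    [StarRing R] [AddLeftMono R] {A : Matrix p p R} {D : Matrix q q R} (hA : A.PosSemidef)
    (hD : D.PosSemidef) : (Matrix.fromBlocks A 0 0 D).PosSemidef := by
  have := Fintype.ofFinite p
  have := Fintype.ofFinite q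
  refine .of_dotProduct_mulVec_nonneg
    (hA.isHermitian.fromBlocks Matrix.conjTranspose_zero hD.isHermitian) fun v => ?_
  have h_split : star v ⬝ᵥ (Matrix.fromBlocks A 0 0 D *ᵥ v) =
      star (v ∘ Sum.inl) ⬝ᵥ (A *ᵥ (v ∘ Sum.inl)) + star (v ∘ Sum.inr) ⬝ᵥ (D *ᵥ (v ∘ Sum.inr)) := by
    simp [Matrix.fromBlocks_mulVec, dotProduct, Fintype.sum_sum_type]
  rw [h_split]
  exact add_nonneg (hA.dotProduct_mulVec_nonneg _) (hD.dotProduct_mulVec_nonneg _)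

end PosSemidef

section Schur

variable {G M : Type*} [MetricSpace M] [Group G] [MulAction G M] {W : Submodule ℂ C(M, ℂ)}

theorem IsIrreducible.exists_eq_smul [FiniteDimensional ℂ W] (hW : IsIrreducible G W)
    (T : Module.End ℂ W)
    (hT : ∀ (g : G) (f f' : W), (∀ x, f'.1 x = f.1 (g • x)) → ∀ x, (T f').1 x = (T f).1 (g • x)) :
    ∃ c : ℂ, ∀ f, T f = c • f := by
  have : Nontrivial W := Submodule.nontrivial_iff_ne_bot.2 hW.2.1
  obtain ⟨c, hc⟩ := Module.End.exists_eigenvalue (K := ℂ) (V := W) T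
  let E : Submodule ℂ W := Module.End.eigenspace (R := ℂ) (M := W) T c
  have hE {f : W} : f ∈ E ↔ T f = c • f := Module.End.mem_eigenspace_iff
  let U : Submodule ℂ C(M, ℂ) := E.map W.subtype
  have hU_inv : IsInvariant G U := by
    rintro g _ ⟨f, hf, rfl⟩
    obtain ⟨f', hf'W, hf'⟩ := hW.1 g f f.2
    refine ⟨f', ⟨⟨f', hf'W⟩, hE.2 ?_, rfl⟩, hf'⟩
    ext x
    simp [hT g f ⟨f', hf'W⟩ hf', hE.1 hf, hf']
  have hU_ne_bot : U ≠ ⊥ := fun h => hc <|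
    Submodule.map_injective_of_injective W.injective_subtype (h.trans (Submodule.map_bot _).symm)
  have hU : U = W := (hW.2.2 U (W.map_subtype_le _) hU_inv).resolve_left hU_ne_bot
  refine ⟨c, fun f => hE.1 ?_⟩
  have hfU : f.1 ∈ U := hU.symm ▸ f.2
  obtain ⟨f', hf', hf'f⟩ := hfU
  rwa [← Subtype.ext hf'f]

end Schur

section KernelOperator

variable {X : Type*} [TopologicalSpace X] [CompactSpace X] [MeasurableSpace X] [BorelSpace X]
  (μ : Measure X) [IsFiniteMeasure μ] {W : Submodule ℂ C(X, ℂ)}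

theorem integrable_smul_kernel (f : C(X, ℂ)) (Z : C(X, W)) :
    Integrable (fun y => f y • Z y) μ :=
  (f • Z).continuous.integrable_of_hasCompactSupport (.of_compactSpace _)

/-- The integral operator `f ↦ ∫ f(y) Z_y dμ(y)` whose kernel `(x, y) ↦ Z_y(x)` is given by its
sections `Z_y ∈ W`. The integral is a Bochner integral in `W`, so the operator maps into `W`;
it is `0` by convention if `W` is not complete. -/
noncomputable def kernelOperator (Z : C(X, W)) : Module.End ℂ W where
  toFun f := ∫ y, f.1 y • Z y ∂μ
  map_add' f₁ f₂ := by
    simp only [Submodule.coe_add, ContinuousMap.add_apply, add_smul]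
    exact integral_add (integrable_smul_kernel μ _ Z) (integrable_smul_kernel μ _ Z)
  map_smul' c f := by
    simp [mul_smul, integral_smul]

theorem kernelOperator_apply [FiniteDimensional ℂ W] (Z : C(X, W)) (f : W) (x : X) :
    (kernelOperator μ Z f).1 x = ∫ y, f.1 y * (Z y).1 x ∂μ := by
  have := FiniteDimensional.complete ℂ W
  let eval : W →L[ℂ] ℂ := (ContinuousMap.evalCLM ℂ x).comp W.subtypeL
  exact (eval.integral_comp_comm (integrable_smul_kernel μ f.1 Z)).symm

end KernelOperator

section InvariantKernel

open scoped ComplexConjugate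

/-- In finite dimension the topology of `W` is that of pointwise convergence, and `x ↦ Z_x(y)` is
continuous because it is the conjugate of `Z_y`. -/
theorem continuous_of_conj_symm {X : Type*} [TopologicalSpace X] {W : Submodule ℂ C(X, ℂ)}
    [FiniteDimensional ℂ W] {Z : X → W} (hZ : ∀ x y, (Z x).1 y = conj ((Z y).1 x)) :
    Continuous Z := by
  let toFun : W →ₗ[ℂ] X → ℂ := (ContinuousMap.coeFnLinearMap ℂ).comp W.subtype
  have h_inj : LinearMap.ker toFun = ⊥ :=
    LinearMap.ker_eq_bot (M := W) (f := toFun).2 (DFunLike.coe_injective.comp W.injective_subtype)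
  rw [(LinearMap.isClosedEmbedding_of_injective (E := W) h_inj).isInducing.continuous_iff]
  refine continuous_pi fun y => ?_
  have h_conj : (fun x => (Z x).1 y) = fun x => conj ((Z y).1 x) :=
    funext fun x => hZ x y
  exact h_conj ▸ Complex.continuous_conj.comp (Z y).1.continuous

/-- A Hermitian kernel `(x, y) ↦ Z_y(x)`, given by its sections `Z_y` in a space `W` of continuous
functions, that is invariant under the diagonal action of `G`. -/
structure IsInvariantKernel (G : Type*) {X : Type*} [TopologicalSpace X] [SMul G X]
    {W : Submodule ℂ C(X, ℂ)} (Z : X → W) : Prop where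
  conj_symm : ∀ x y, (Z x).1 y = conj ((Z y).1 x)
  smul_smul : ∀ (g : G) x y, (Z (g • x)).1 (g • y) = (Z x).1 y

variable {G M : Type*} [MetricSpace M] [CompactSpace M] [MeasurableSpace M] [BorelSpace M]
  [Group G] [MulAction G M] [ContinuousConstSMul G M] (μ : Measure M) [IsFiniteMeasure μ]
  [SMulInvariantMeasure G M μ] {W : Submodule ℂ C(M, ℂ)} [FiniteDimensional ℂ W] {Z : M → W}

theorem IsInvariantKernel.exists_inner_toLp_eq_mul (hZ : IsInvariantKernel G Z)
    (hW : IsIrreducible G W) :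
    ∃ c : ℂ, ∀ (f : W) (x : M),
      inner ℂ (ContinuousMap.toLp 2 μ ℂ (Z x).1) (ContinuousMap.toLp 2 μ ℂ f.1) = c * f.1 x := by
  let T := kernelOperator μ ⟨Z, continuous_of_conj_symm hZ.conj_symm⟩
  have hT (f : W) (x : M) : (T f).1 x = ∫ y, f.1 y * (Z y).1 x ∂μ := kernelOperator_apply μ _ f x
  obtain ⟨c, hc⟩ := hW.exists_eq_smul T fun g f f' hf' x => by
    rw [hT, hT, ← integral_smul_eq_self (μ := μ) (g := g) fun y => f.1 y * (Z y).1 (g • x)]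
    simp only [hf', hZ.smul_smul]
  refine ⟨c, fun f x => ?_⟩
  calc inner ℂ (ContinuousMap.toLp 2 μ ℂ (Z x).1) (ContinuousMap.toLp 2 μ ℂ f.1)
      = ∫ y, f.1 y * conj ((Z x).1 y) ∂μ := ContinuousMap.inner_toLp μ _ _
    _ = (T f).1 x := by simp only [hT, ← hZ.conj_symm]
    _ = c * f.1 x := by simp [hc]

open scoped ComplexOrder in
/-- By Schur's lemma, `Z` is a positive multiple of the Gram matrix of its own sections in
`L²(μ)`. -/
theorem IsInvariantKernel.posSemidef [Nonempty M] [μ.IsOpenPosMeasure]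
    (hZ : IsInvariantKernel G Z) (hW : IsIrreducible G W) (hZ_one : ∀ x, (Z x).1 x = 1) :
    (Matrix.of fun x y => (Z y).1 x).PosSemidef := by
  obtain ⟨c, hc⟩ := hZ.exists_inner_toLp_eq_mul μ hW
  let v (x : M) := ContinuousMap.toLp 2 μ ℂ (Z x).1
  obtain ⟨x₀⟩ := ‹Nonempty M›
  have hc_norm : c = (‖v x₀‖ ^ 2 : ℝ) := by
    simpa [v, hZ_one, inner_self_eq_norm_sq_to_K] using (hc (Z x₀) x₀).symm
  have hv_ne : v x₀ ≠ 0 := fun h => by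
    have hZ_zero : (Z x₀).1 = 0 :=
      ContinuousMap.toLp_injective (p := 2) (𝕜 := ℂ) μ (by simpa using h)
    simpa [hZ_zero] using hZ_one x₀
  have h_gram : (Matrix.of fun x y => (Z y).1 x) = (‖v x₀‖ ^ 2)⁻¹ • Matrix.gram ℂ v := by
    ext x y
    simp [v, hc, hc_norm, hv_ne]
  rw [h_gram]
  exact (gram_posSemidef v).smul (by positivity)

end InvariantKernel

section Zonal

variable {G M : Type*} [MetricSpace M] [Group G] [MulAction G M]

theorem IsTwoPointHomogeneous.isIsometricSMul (hM : IsTwoPointHomogeneous G M) :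
    IsIsometricSMul G M :=
  ⟨fun g => Isometry.of_dist_eq (hM.dist_smul g)⟩

theorem IsTwoPointHomogeneous.isPretransitive (hM : IsTwoPointHomogeneous G M) :
    MulAction.IsPretransitive G M :=
  ⟨fun x y =>
    have ⟨g, hg, _⟩ := hM.exists_smul x x y y (by simp only [dist_self])
    ⟨g, hg⟩⟩

theorem isOpenPosMeasure_of_isMinimal (G : Type*) {X : Type*} [TopologicalSpace X] [CompactSpace X]
    [MeasurableSpace X] [Group G] [MulAction G X] [ContinuousConstSMul G X]
    [MulAction.IsMinimal G X] (μ : Measure X) [NeZero μ] [SMulInvariantMeasure G X μ] :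
    μ.IsOpenPosMeasure :=
  ⟨fun _ hU hU_ne => (measure_isOpen_pos_of_smulInvariant_of_compact_ne_zero G
    isCompact_univ (Measure.measure_univ_ne_zero.2 (NeZero.ne μ)) hU hU_ne).ne'⟩

theorem tau_comm (F : ℝ → ℝ) (x y : M) : tau F x y = tau F y x := by
  rw [tau, tau, dist_comm]

theorem tau_smul_smul [IsIsometricSMul G M] (F : ℝ → ℝ) (g : G) (x y : M) :
    tau F (g • x) (g • y) = tau F x y := by
  rw [tau, tau, dist_smul]

theorem IsZonalSpherical.posSemidef [CompactSpace M] [Nonempty M] [MeasurableSpace M] [BorelSpace M]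
    [IsIsometricSMul G M] (μ : Measure M) [IsFiniteMeasure μ] [μ.IsOpenPosMeasure]
    [SMulInvariantMeasure G M μ] {F : ℝ → ℝ} {W : Submodule ℂ C(M, ℂ)} [FiniteDimensional ℂ W]
    (hW : IsIrreducible G W) {φ : ℝ[X]} (hφ : IsZonalSpherical F W φ) :
    (Matrix.of fun x y : M => φ.eval (tau F x y)).PosSemidef := by
  choose z hzW hz using hφ.mem
  let Z (x : M) : W := ⟨z x, hzW x⟩
  have hZ : IsInvariantKernel G Z :=
    { conj_symm := fun x y => by simp [Z, hz, tau_comm F x y]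
      smul_smul := fun g x y => by simp [Z, hz, tau_smul_smul] }
  refine posSemidef_of_map_ofReal ?_
  convert hZ.posSemidef μ hW (fun x => by simp [Z, hz, hφ.normalized]) using 1
  ext x y
  simp [Z, hz, tau_comm F x y]

end Zonal

section Hankel

theorem posSemidef_weighted_moments {ι : Type*} (P : Finset ι) {w : ι → ℝ} (t : ι → ℝ)
    (hw : ∀ p ∈ P, 0 ≤ w p) (m : ℕ) :
    (Matrix.of fun i j : Fin m => ∑ p ∈ P, w p * t p ^ ((i : ℕ) + j)).PosSemidef := by
  have h_sum : (Matrix.of fun i j : Fin m => ∑ p ∈ P, w p * t p ^ ((i : ℕ) + j)) =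
      ∑ p ∈ P, w p • Matrix.vecMulVec (fun i : Fin m => t p ^ (i : ℕ))
        (star fun i : Fin m => t p ^ (i : ℕ)) := by
    ext i j
    simp [Matrix.sum_apply, Matrix.vecMulVec_apply, pow_add]
  rw [h_sum]
  exact Matrix.posSemidef_sum _ fun p hp =>
    (Matrix.posSemidef_vecMulVec_self_star _).smul (hw p hp)

variable {ι : Type*} (P : Finset ι) (t : ι → ℝ) {α β : ℝ} (m : ℕ)

theorem posSemidef_hankelR_sum_pow :
    (hankelR fun d : Fin (2 * m) => ∑ p ∈ P, t p ^ (d : ℕ)).PosSemidef := by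
  convert posSemidef_weighted_moments P t (fun _ _ => zero_le_one) m using 1
  ext i j
  simp only [hankelR, Matrix.of_apply, one_mul]

theorem posSemidef_hankelPlus_sum_pow (ht : ∀ p ∈ P, α ≤ t p) :
    (hankelPlus (fun d : Fin (2 * m) => ∑ p ∈ P, t p ^ (d : ℕ)) α).PosSemidef := by
  convert posSemidef_weighted_moments P t (fun p hp => sub_nonneg.2 (ht p hp)) m using 1
  ext i j
  simp only [hankelPlus, Matrix.of_apply, Finset.mul_sum, ← Finset.sum_sub_distrib, sub_mul,
    pow_succ']

theorem posSemidef_hankelMinus_sum_pow (ht : ∀ p ∈ P, t p ≤ β) :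
    (hankelMinus (fun d : Fin (2 * m) => ∑ p ∈ P, t p ^ (d : ℕ)) β).PosSemidef := by
  convert posSemidef_weighted_moments P t (fun p hp => sub_nonneg.2 (ht p hp)) m using 1
  ext i j
  simp only [hankelMinus, Matrix.of_apply, Finset.mul_sum, ← Finset.sum_sub_distrib, sub_mul,
    pow_succ']

theorem posSemidef_hankelH_sum_pow (ht : ∀ p ∈ P, t p ∈ Set.Icc α β) :
    (hankelH (fun d : Fin (2 * m) => ∑ p ∈ P, t p ^ (d : ℕ)) α β).PosSemidef :=
  posSemidef_fromBlocks_zero (posSemidef_hankelR_sum_pow P t m) <|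
    posSemidef_fromBlocks_zero (posSemidef_hankelPlus_sum_pow P t m fun p hp => (ht p hp).1)
      (posSemidef_hankelMinus_sum_pow P t m fun p hp => (ht p hp).2)

end Hankel

section Piece

variable {ℓ : ℕ} {u : Fin (ℓ + 1) → ℝ}

theorem piece_subset_Icc (i : Fin ℓ) : piece u i ⊆ Set.Icc (u i.castSucc) (u i.succ) := by
  unfold piece
  split_ifs
  exacts [subset_rfl, Set.Ico_subset_Icc_self]

theorem pairwise_disjoint_piece (hu : Monotone u) :
    Pairwise (Function.onFun Disjoint (piece u)) := by
  refine (pairwise_disjoint_on _).2 fun i j hij => Set.disjoint_left.2 fun t hti htj => ?_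
  have hi_not_last : (i : ℕ) + 1 ≠ ℓ := by omega
  rw [piece, if_neg hi_not_last] at hti
  have h_le : u i.succ ≤ u j.castSucc := hu (Fin.succ_le_castSucc_iff.2 hij)
  exact (hti.2.trans_le h_le).not_ge (piece_subset_Icc j htj).1

theorem exists_mem_piece (hℓ : 0 < ℓ) {t : ℝ} (ht : t ∈ Set.Icc (u 0) (u (Fin.last ℓ))) :
    ∃ i, t ∈ piece u i := by
  have : NeZero ℓ := ⟨hℓ.ne'⟩
  obtain ⟨i, hi, hi_max⟩ := (Set.toFinite {i : Fin ℓ | u i.castSucc ≤ t}).exists_maximal ⟨0, ht.1⟩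
  refine ⟨i, ?_⟩
  unfold piece
  split_ifs with h_last
  · have hi_succ : i.succ = Fin.last ℓ := Fin.ext h_last
    exact ⟨hi, hi_succ ▸ ht.2⟩
  · refine ⟨hi, lt_of_not_ge fun h_le => ?_⟩
    have h_next := hi_max (y := ⟨i + 1, by omega⟩) h_le
    simp [Fin.le_def] at h_next

theorem existsUnique_mem_piece (hℓ : 0 < ℓ) (hu : Monotone u) {t : ℝ}
    (ht : t ∈ Set.Icc (u 0) (u (Fin.last ℓ))) : ∃! i, t ∈ piece u i :=
  have ⟨i, hi⟩ := exists_mem_piece hℓ ht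
  ⟨i, hi, fun _ hj => (pairwise_disjoint_piece hu).eq (Set.not_disjoint_iff.2 ⟨t, hj, hi⟩)⟩

end Piece

section Code

variable {M : Type*} [MetricSpace M] {F : ℝ → ℝ} {ℓ : ℕ} {u : Fin (ℓ + 1) → ℝ} {C : Finset M}

open Classical in
theorem IsCode.sum_powerSum (hC : IsCode F (Set.Icc (u 0) (u (Fin.last ℓ))) C) (hℓ : 0 < ℓ)
    (hu : Monotone u) (d : ℕ) :
    ∑ i, powerSum F u C i d = ∑ p ∈ C.offDiag, tau F p.1 p.2 ^ d := by
  simp only [powerSum, Finset.sum_filter]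
  rw [Finset.sum_comm]
  refine Finset.sum_congr rfl fun p hp => ?_
  obtain ⟨hp₁, hp₂, hp_ne⟩ := Finset.mem_offDiag.1 hp
  obtain ⟨i, hi, hi_unique⟩ := existsUnique_mem_piece hℓ hu (hC _ hp₁ _ hp₂ hp_ne)
  rw [Fintype.sum_eq_single i fun j hj => if_neg fun h => hj (hi_unique j h), if_pos hi]

theorem IsCode.card_add_sum_powerSum_zero (hC : IsCode F (Set.Icc (u 0) (u (Fin.last ℓ))) C)
    (hℓ : 0 < ℓ) (hu : Monotone u) :
    (C.card : ℝ) + ∑ i, powerSum F u C i 0 = (C.card : ℝ) * C.card := by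
  classical
  simp [hC.sum_powerSum hℓ hu, Finset.offDiag_card, Nat.cast_sub (Nat.le_mul_self C.card)]

theorem IsCode.card_add_sum_coeff_mul_powerSum
    (hC : IsCode F (Set.Icc (u 0) (u (Fin.last ℓ))) C) (hℓ : 0 < ℓ) (hu : Monotone u) {φ : ℝ[X]}
    {k : ℕ} (hφ : ∀ x : M, φ.eval (tau F x x) = 1) (hk : φ.natDegree ≤ k) :
    (C.card : ℝ) + ∑ d : Fin (k + 1), φ.coeff d * ∑ i, powerSum F u C i d =
      ∑ x ∈ C, ∑ y ∈ C, φ.eval (tau F x y) := by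
  classical
  have h_diag : ∑ p ∈ C.diag, φ.eval (tau F p.1 p.2) = C.card := by
    simp [Finset.sum_diag, hφ]
  have h_offDiag : ∑ p ∈ C.offDiag, φ.eval (tau F p.1 p.2) =
      ∑ d : Fin (k + 1), φ.coeff d * ∑ i, powerSum F u C i d := by
    simp only [hC.sum_powerSum hℓ hu, Finset.mul_sum]
    rw [Finset.sum_comm]
    refine Finset.sum_congr rfl fun p _ => ?_
    rw [Polynomial.eval_eq_sum_range' (Nat.lt_succ_of_le hk), Finset.sum_range]
  rw [← Finset.sum_product' C C, ← Finset.diag_union_offDiag,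
    Finset.sum_union (Finset.disjoint_diag_offDiag _), h_diag, h_offDiag]

theorem IsCode.isFeasible (hC : IsCode F (Set.Icc (u 0) (u (Fin.last ℓ))) C) (hℓ : 0 < ℓ)
    (hu : Monotone u) {N : ℕ∞} {Φ : ℕ → ℝ[X]}
    (hΦ : ∀ k : ℕ, (k : ℕ∞) ≤ N → (Matrix.of fun x y : M => (Φ k).eval (tau F x y)).PosSemidef)
    (hΦ_one : ∀ k : ℕ, (k : ℕ∞) ≤ N → ∀ x : M, (Φ k).eval (tau F x x) = 1)
    (hdeg : ∀ k : ℕ, (k : ℕ∞) ≤ N → (Φ k).natDegree ≤ k) {m : ℕ} (hm : 0 < m)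
    {Ad : Set (PsdConstraint ℓ m)}
    (hAd : ∀ L ∈ Ad, L.Holds (C.card : ℝ) (fun i d => powerSum F u C i d)) :
    IsFeasible N Φ u m hm Ad C.card (fun i d => powerSum F u C i d) where
  gamma := by
    rw [hC.card_add_sum_powerSum_zero hℓ hu]
    convert Matrix.posSemidef_vecMulVec_self_star ![1, (C.card : ℝ)] using 1
    ext i j
    fin_cases i <;> fin_cases j <;> simp [Matrix.vecMulVec_apply]
  delsarte k _ _ hkN := by
    rw [hC.card_add_sum_coeff_mul_powerSum hℓ hu (hΦ_one k hkN) (hdeg k hkN)]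
    exact sum_sum_nonneg_of_posSemidef (hΦ k hkN) C
  hankel i := by
    classical
    exact posSemidef_hankelH_sum_pow _ _ m fun p hp =>
      piece_subset_Icc i (Finset.mem_filter.1 hp).2
  additional := hAd

theorem maxCodeSize_le [Nonempty M] {S : Set ℝ} {v : EReal}
    (hv : ∀ C : Finset M, C.Nonempty → IsCode F S C → ((C.card : ℝ) : EReal) ≤ v) :
    ((maxCodeSize M F S : ℝ≥0∞) : EReal) ≤ v := by
  have hv_nonneg : 0 ≤ v := by
    obtain ⟨x⟩ := ‹Nonempty M›
    have h_one := hv {x} (Finset.singleton_nonempty x) (by simp [IsCode])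
    exact zero_le_one.trans (by simpa using h_one)
  lift v to ℝ≥0∞ using hv_nonneg
  rw [EReal.coe_ennreal_le_coe_ennreal_iff, maxCodeSize]
  simp only [ENat.toENNReal_iSup, ENat.toENNReal_coe]
  refine iSup₂_le fun C hC => ?_
  obtain rfl | hC_ne := C.eq_empty_or_nonempty
  · simp
  · rw [← EReal.coe_ennreal_le_coe_ennreal_iff, ← ENNReal.ofReal_natCast, EReal.coe_ennreal_ofReal,
      max_eq_left C.card.cast_nonneg]
    exact hv C hC_ne hC

end Code

end CodeBound

open CodeBound in
theorem theorem6p1_general {M : Type*} [MetricSpace M] [Nonempty M] (F : ℝ → ℝ) (N : ℕ∞)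
    (Φ : ℕ → ℝ[X])
    (hΦ : ∀ k : ℕ, (k : ℕ∞) ≤ N → (Matrix.of fun x y : M => (Φ k).eval (tau F x y)).PosSemidef)
    (hΦ_one : ∀ k : ℕ, (k : ℕ∞) ≤ N → ∀ x : M, (Φ k).eval (tau F x x) = 1)
    (hdeg : ∀ k : ℕ, (k : ℕ∞) ≤ N → (Φ k).natDegree ≤ k) {ℓ : ℕ} (hℓ : 0 < ℓ)
    {u : Fin (ℓ + 1) → ℝ} (hu : Monotone u) {S : Set ℝ} (hS : S ⊆ Set.Icc (u 0) (u (Fin.last ℓ)))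
    {m : ℕ} (hm : 0 < m) (Ad : Set (PsdConstraint ℓ m))
    (hAd : ∀ C : Finset M, C.Nonempty → IsCode F S C →
      ∀ L ∈ Ad, L.Holds (C.card : ℝ) (fun i d => powerSum F u C i d)) :
    ((maxCodeSize M F S : ℝ≥0∞) : EReal) ≤ optimalValue N Φ u m hm Ad :=
  maxCodeSize_le fun C hC_ne hC =>
    have hC' : IsCode F (Set.Icc (u 0) (u (Fin.last ℓ))) C :=
      fun x hx y hy hxy => hS (hC x hx y hy hxy)
    le_sSup ⟨_, _, hC'.isFeasible hℓ hu hΦ hΦ_one hdeg hm (hAd C hC_ne hC), rfl⟩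

theorem theorem6p1 {M G : Type*} [MetricSpace M] [CompactSpace M] [Nonempty M]
    [MeasurableSpace M] [BorelSpace M] [Group G] [MulAction G M]
    (hM : CodeBound.IsTwoPointHomogeneous G M)
    -- the normalized invariant measure on `M`
    (μ : Measure M) [IsProbabilityMeasure μ] [SMulInvariantMeasure G M μ]
    -- `τ = F ∘ ρ` and the zonal spherical functions, which are polynomials of degree `k` in `τ`
    (F : ℝ → ℝ) (N : ℕ∞) (V : ℕ → Submodule ℂ C(M, ℂ))
    (hV : CodeBound.IsHarmonicDecomposition G μ N V)
    (Φ : ℕ → ℝ[X])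
    (hΦ : ∀ k : ℕ, (k : ℕ∞) ≤ N → CodeBound.IsZonalSpherical F (V k) (Φ k))
    (hdeg : ∀ k : ℕ, (k : ℕ∞) ≤ N → (Φ k).natDegree = k)
    -- `S = T ∩ [a, b]`, with `[a, b]` cut into `ℓ ≥ 1` subintervals
    (a b : ℝ) (ℓ : ℕ) (hℓ : 0 < ℓ) (u : Fin (ℓ + 1) → ℝ) (hu : StrictMono u)
    (hua : u 0 = a) (hub : u (Fin.last ℓ) = b)
    (S : Set ℝ) (hS : S = CodeBound.tauRange M F ∩ Set.Icc a b)
    (m : ℕ) (hm : 0 < m)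
    -- the additional constraints, each of them a valid constraint for `S`-codes
    (Ad : Set (CodeBound.PsdConstraint ℓ m))
    (hAd : ∀ C : Finset M, C.Nonempty → CodeBound.IsCode F S C →
      ∀ L ∈ Ad, L.Holds (C.card : ℝ) (fun i d => CodeBound.powerSum F u C i d)) :
    (((CodeBound.maxCodeSize M F S : ℕ∞) : ℝ≥0∞) : EReal) ≤
      CodeBound.optimalValue N Φ u m hm Ad := by
  have := hM.isIsometricSMul
  have := hM.isPretransitive
  have := CodeBound.isOpenPosMeasure_of_isMinimal G μ
  refine theorem6p1_general F N Φ (fun k hk => ?_) (fun k hk => (hΦ k hk).normalized)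
    (fun k hk => (hdeg k hk).le) hℓ hu.monotone (by simp [hS, hua, hub]) hm Ad hAd
  have := hV.finiteDimensional k hk
  exact (hΦ k hk).posSemidef μ (hV.irreducible k hk)
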